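/- Let $G$ be a precompact Hausdorff abelian topological group (that is, its Raĭkov completion is compact) of square-free exponent, i.e. the least positive integer $n$ with $nx=0$ for all $x\in G$ exists and is square-free. Then the following are equivalent: (a) $G$ is compact; (b) $G$ is minimal, i.e. every Hausdorff group topology on $G$ that is coarser than or equal to the given topology $\tau$ equals $\tau$; (c) $G$ is locally minimal, i.e. there is a $\tau$-neighborhood $V$ of $0$ such that every Hausdorff group topology $\sigma\subseteq\tau$ on $G$ for which $V$ is a $\sigma$-neighborhood of $0$ equals $\tau$. -/

import Mathlib

/-- An abelian topological group is precompact if its completion (with respect to the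
group uniformity; for an abelian group the left, right and two-sided uniformities agree,
so this is the Raikov completion) is compact. -/
def IsPrecompactAddGroup (G : Type*) [AddCommGroup G] [TopologicalSpace G]
    [IsTopologicalAddGroup G] : Prop :=
  letI : UniformSpace G := IsTopologicalAddGroup.rightUniformSpace G
  CompactSpace (UniformSpace.Completion G)

/-- A Hausdorff topological group `(G, τ)` is minimal if every Hausdorff group topology `σ`
on `G` coarser than `τ` equals `τ`. In Mathlib's order on topologies, `τ ≤ σ` means that `σ` is
coarser than `τ`. -/
def IsMinimalAddGroup (G : Type*) [AddCommGroup G] [τ : TopologicalSpace G]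
    [IsTopologicalAddGroup G] : Prop :=
  T2Space G ∧ ∀ σ : TopologicalSpace G,
    @IsTopologicalAddGroup G σ _ → @T2Space G σ → τ ≤ σ → σ = τ

/-- A Hausdorff topological group `(G, τ)` is locally minimal if there is a `τ`-neighborhood `V`
of `0` such that every Hausdorff group topology `σ` on `G`, coarser than `τ` and for which `V` is
still a neighborhood of `0`, equals `τ`. -/
def IsLocallyMinimalAddGroup (G : Type*) [AddCommGroup G] [τ : TopologicalSpace G]
    [IsTopologicalAddGroup G] : Prop :=
  T2Space G ∧ ∃ V ∈ @nhds G τ 0, ∀ σ : TopologicalSpace G,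
    @IsTopologicalAddGroup G σ _ → @T2Space G σ → τ ≤ σ → V ∈ @nhds G σ 0 → σ = τ

/-!
If `G` is locally minimal and dense in a Hausdorff group `K`, then small closed subgroups `N` of `K`
with `N ∩ G = 0` vanish: `G` embeds in `K ⧸ N`, local minimality shows that the topology it inherits
there is its own, and by density this forces `N = 0`. When `G` has squarefree exponent `n`, so has
`K`. For `n = p * m` with `p` prime, any `x : K` differs by an element of `G` from an element close
to `0`, whose `m`-th multiple generates a small subgroup, trivial or of order `p`, and hence
contained in `G`. So `(n / p) • x ∈ G` for every prime `p ∣ n`; since `n` is squarefree, the numbers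
`n / p` are coprime, and `x ∈ G`. Thus `G = K`; with `K` the completion of `G`, this says that `G`
is complete.
-/

open Filter Topology

theorem eq_zero_of_forall_prime_mul_eq_nsmul_eq_zero {A : Type*} [AddMonoid A] {n : ℕ}
    (hn : Squarefree n) {x : A} (hx : n • x = 0)
    (h : ∀ p m : ℕ, p.Prime → p * m = n → m • x = 0) : x = 0 := by
  rw [← AddMonoid.addOrderOf_eq_one_iff]
  by_contra hne
  obtain ⟨p, hp, hpx⟩ := Nat.exists_prime_and_dvd hne
  obtain ⟨m, rfl⟩ : p ∣ n := hpx.trans (addOrderOf_dvd_of_nsmul_eq_zero hx)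
  have hpm : p ∣ m := hpx.trans (addOrderOf_dvd_of_nsmul_eq_zero (h p m hp rfl))
  exact hp.not_isUnit (hn p (mul_dvd_mul_left p hpm))

theorem mem_of_forall_prime_mul_eq_nsmul_mem {A : Type*} [AddCommGroup A] {H : AddSubgroup A}
    {n : ℕ} (hn : Squarefree n) {x : A} (hx : n • x ∈ H)
    (h : ∀ p m : ℕ, p.Prime → p * m = n → m • x ∈ H) : x ∈ H := by
  simp only [← QuotientAddGroup.eq_zero_iff, QuotientAddGroup.mk_nsmul] at hx h ⊢
  exact eq_zero_of_forall_prime_mul_eq_nsmul_eq_zero hn hx h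

theorem disjoint_zmultiples_of_prime_nsmul_eq_zero {A : Type*} [AddGroup A] {H : AddSubgroup A}
    {p : ℕ} (hp : p.Prime) {y : A} (hy : p • y = 0) (hyH : y ∉ H) :
    Disjoint H (AddSubgroup.zmultiples y) := by
  have hy0 : y ≠ 0 := fun h => hyH (h ▸ H.zero_mem)
  have : Fact p.Prime := ⟨hp⟩
  have : Fact (Nat.card (AddSubgroup.zmultiples y)).Prime := ⟨by
    rwa [Nat.card_zmultiples, addOrderOf_eq_prime hy hy0]⟩
  rw [← AddSubgroup.addSubgroupOf_eq_bot]
  refine (AddSubgroup.eq_bot_or_eq_top_of_prime_card _).resolve_right fun htop => hyH ?_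
  rwa [AddSubgroup.addSubgroupOf_eq_top, AddSubgroup.zmultiples_le] at htop

theorem eq_of_compactSpace_of_t2Space_of_le {X : Type*} {τ σ : TopologicalSpace X}
    (hτ : @CompactSpace X τ) (hσ : @T2Space X σ) (hle : τ ≤ σ) : σ = τ := by
  obtain ⟨⟨hcoinduced⟩, -⟩ : @IsQuotientMap X X τ σ id :=
    @IsQuotientMap.of_surjective_continuous X X τ σ hτ hσ id Function.surjective_id
      (continuous_id_of_le hle)
  exact hcoinduced.trans (@coinduced_id X τ)

theorem eq_of_map_eq_of_isInducing_comp {X Y Z : Type*} [TopologicalSpace X] [TopologicalSpace Y]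
    [T2Space Y] [TopologicalSpace Z] {i : X → Y} {q : Y → Z} (hi : Continuous i)
    (hdense : DenseRange i) (hq : Continuous q) (hqi : IsInducing (q ∘ i)) {x : X} {y : Y}
    (h : q y = q (i x)) : y = i x := by
  have : (comap i (𝓝 y)).NeBot := comap_neBot fun _ hs => hdense.mem_nhds hs
  have hx : comap i (𝓝 y) ≤ 𝓝 x :=
    calc comap i (𝓝 y) ≤ comap i (comap q (𝓝 (q y))) := comap_mono (hq.tendsto y).le_comap
      _ = 𝓝 x := by rw [comap_comap, h, hqi.nhds_eq_comap, Function.comp_apply]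
  exact tendsto_nhds_unique tendsto_comap ((hi.tendsto x).mono_left hx)

theorem exponent_nsmul_eq_zero_of_denseRange {G K : Type*} [AddMonoid G] [AddMonoid K]
    [TopologicalSpace K] [ContinuousAdd K] [T2Space K] {i : G →+ K} (hi : DenseRange i) (x : K) :
    AddMonoid.exponent G • x = 0 := by
  refine congrFun (hi.equalizer (continuous_nsmul _) continuous_zero (funext fun g => ?_)) x
  simp only [Function.comp_apply, ← map_nsmul, AddMonoid.exponent_nsmul_eq_zero, map_zero,
    Pi.zero_apply]

theorem eventually_zmultiples_subset_of_nsmul_eq_zero {K : Type*} [AddGroup K] [TopologicalSpace K]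
    [ContinuousAdd K] {n : ℕ} (hn : 0 < n) {W : Set K} (hW : W ∈ 𝓝 (0 : K)) :
    ∀ᶠ y in 𝓝 (0 : K), n • y = 0 → (AddSubgroup.zmultiples y : Set K) ⊆ W := by
  have hmultiples : ∀ᶠ y in 𝓝 (0 : K), ∀ k ∈ Set.Iio n, k • y ∈ W := by
    rw [eventually_all_finite (Set.finite_Iio n)]
    intro k _
    exact ((continuous_nsmul k).tendsto' 0 0 (nsmul_zero k)).eventually_mem hW
  filter_upwards [hmultiples] with y hy hny z hz
  have hfin : IsOfFinAddOrder y := isOfFinAddOrder_iff_nsmul_eq_zero.2 ⟨n, hn, hny⟩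
  classical
  obtain ⟨k, hk, rfl⟩ :=
    Finset.mem_image.1 (hfin.mem_zmultiples_iff_mem_range_addOrderOf.1 hz)
  exact hy k ((Finset.mem_range.1 hk).trans_le (addOrderOf_le_of_nsmul_eq_zero hn hny))

theorem exists_nhds_zero_forall_mem_comap_mk {K : Type*} [AddGroup K] [TopologicalSpace K]
    [IsTopologicalAddGroup K] {U : Set K} (hU : U ∈ 𝓝 (0 : K)) :
    ∃ W ∈ 𝓝 (0 : K), ∀ N : AddSubgroup K, (N : Set K) ⊆ W →
      U ∈ comap ((↑) : K → K ⧸ N) (𝓝 ((0 : K) : K ⧸ N)) := by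
  obtain ⟨W, hW, hWU⟩ := exists_nhds_zero_half hU
  refine ⟨W, hW, fun N hNW => ⟨_, QuotientAddGroup.isOpenMap_coe.image_mem_nhds hW, ?_⟩⟩
  rintro x ⟨w, hw, hwx⟩
  have hmem : -w + x ∈ N := QuotientAddGroup.eq.1 hwx
  simpa only [add_neg_cancel_left] using hWU w hw _ (hNW hmem)

/-- A subgroup `H` of a topological group `K` is locally essential if it meets nontrivially every
nontrivial closed subgroup of `K` contained in some fixed neighborhood of `0`. -/
def IsLocallyEssential {K : Type*} [AddCommGroup K] [TopologicalSpace K] (H : AddSubgroup K) :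
    Prop :=
  ∃ W ∈ 𝓝 (0 : K), ∀ N : AddSubgroup K, IsClosed (N : Set K) → (N : Set K) ⊆ W →
    Disjoint H N → N = ⊥

namespace IsLocallyEssential

variable {K : Type*} [AddCommGroup K] [TopologicalSpace K] [IsTopologicalAddGroup K] [T1Space K]
  {H : AddSubgroup K}

theorem eventually_mem_of_prime_nsmul_eq_zero (hH : IsLocallyEssential H) {p : ℕ} (hp : p.Prime) :
    ∀ᶠ y in 𝓝 (0 : K), p • y = 0 → y ∈ H := by
  obtain ⟨W, hW, hWH⟩ := hH
  filter_upwards [eventually_zmultiples_subset_of_nsmul_eq_zero hp.pos hW] with y hyW hpy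
  by_contra hyH
  have hfin : (AddSubgroup.zmultiples y : Set K).Finite :=
    finite_zmultiples.2 (isOfFinAddOrder_iff_nsmul_eq_zero.2 ⟨p, hp.pos, hpy⟩)
  have hbot : AddSubgroup.zmultiples y = ⊥ :=
    hWH _ hfin.isClosed (hyW hpy) (disjoint_zmultiples_of_prime_nsmul_eq_zero hp hpy hyH)
  exact hyH (AddSubgroup.zmultiples_eq_bot.1 hbot ▸ H.zero_mem)

theorem nsmul_mem_of_prime_nsmul_eq_zero (hH : IsLocallyEssential H) (hdense : Dense (H : Set K))
    {p m : ℕ} (hp : p.Prime) (hpm : ∀ x : K, p • m • x = 0) (x : K) : m • x ∈ H := by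
  have hcont : Continuous fun z : K => m • (x - z) := by fun_prop
  have hnear : ∀ᶠ z in 𝓝 x, m • (x - z) ∈ H := by
    filter_upwards [(hcont.tendsto' x 0 (by rw [sub_self, nsmul_zero])).eventually
      (hH.eventually_mem_of_prime_nsmul_eq_zero hp)] with z hz
    exact hz (hpm _)
  obtain ⟨z, hz, hzH⟩ := mem_closure_iff_nhds.1 (hdense x) _ hnear
  have hsum : m • (x - z) + m • z ∈ H := H.add_mem hz (H.nsmul_mem hzH m)
  rwa [← nsmul_add, sub_add_cancel] at hsum

theorem eq_top_of_dense (hH : IsLocallyEssential H) (hdense : Dense (H : Set K)) {n : ℕ}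
    (hn : Squarefree n) (hK : ∀ x : K, n • x = 0) : H = ⊤ := by
  refine (AddSubgroup.eq_top_iff' H).2 fun x =>
    mem_of_forall_prime_mul_eq_nsmul_mem hn (hK x ▸ H.zero_mem) fun p m hp hpm => ?_
  refine hH.nsmul_mem_of_prime_nsmul_eq_zero hdense hp (fun y => ?_) x
  rw [← mul_nsmul', hpm, hK]

end IsLocallyEssential

theorem isMinimalAddGroup_of_compactSpace (G : Type*) [AddCommGroup G] [TopologicalSpace G]
    [IsTopologicalAddGroup G] [T2Space G] [CompactSpace G] : IsMinimalAddGroup G :=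
  ⟨inferInstance, fun _ _ hσ hle => eq_of_compactSpace_of_t2Space_of_le ‹_› hσ hle⟩

theorem IsMinimalAddGroup.isLocallyMinimalAddGroup {G : Type*} [AddCommGroup G]
    [TopologicalSpace G] [IsTopologicalAddGroup G] (h : IsMinimalAddGroup G) :
    IsLocallyMinimalAddGroup G :=
  ⟨h.1, Set.univ, univ_mem, fun σ hσ hT2 hle _ => h.2 σ hσ hT2 hle⟩

namespace IsLocallyMinimalAddGroup

theorem exists_nhds_forall_isInducing {G : Type*} [AddCommGroup G] [TopologicalSpace G]
    [IsTopologicalAddGroup G] (hG : IsLocallyMinimalAddGroup G) :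
    ∃ V ∈ 𝓝 (0 : G), ∀ {L : Type*} [AddGroup L] [TopologicalSpace L] [IsTopologicalAddGroup L]
      [T2Space L] (f : G →+ L), Continuous f → Function.Injective f → V ∈ comap f (𝓝 0) →
      IsInducing f := by
  obtain ⟨-, V, hV, hmin⟩ := hG
  refine ⟨V, hV, fun f hcont hinj hVf => ⟨(hmin (.induced f inferInstance) ?_ ?_ ?_ ?_).symm⟩⟩
  · exact topologicalAddGroup_induced f
  · exact @T2Space.of_injective_continuous _ _ (.induced f inferInstance) _ _ f hinj
      continuous_induced_dom
  · exact continuous_iff_le_induced.1 hcont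
  · rwa [nhds_induced, map_zero]

theorem isLocallyEssential_range {G K : Type*} [AddCommGroup G] [TopologicalSpace G]
    [IsTopologicalAddGroup G] [AddCommGroup K] [TopologicalSpace K] [IsTopologicalAddGroup K]
    [T2Space K] (hG : IsLocallyMinimalAddGroup G) {i : G →+ K} (hi : IsDenseEmbedding i) :
    IsLocallyEssential i.range := by
  obtain ⟨V, hV, hmin⟩ := hG.exists_nhds_forall_isInducing
  rw [hi.isInducing.nhds_eq_comap, map_zero] at hV
  obtain ⟨U, hU, hUV⟩ := hV
  obtain ⟨W, hW, hWU⟩ := exists_nhds_zero_forall_mem_comap_mk hU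
  refine ⟨W, hW, fun N hN hNW hdisj => ?_⟩
  have : IsClosed (N : Set K) := hN
  let q : K →+ K ⧸ N := QuotientAddGroup.mk' N
  have hq : Continuous q := QuotientAddGroup.continuous_mk
  have hinj : Function.Injective (q.comp i) := by
    refine (injective_iff_map_eq_zero _).2 fun g hg => ?_
    have hgN : i g ∈ N := (QuotientAddGroup.eq_zero_iff _).1 hg
    exact hi.injective ((AddSubgroup.disjoint_def.1 hdisj ⟨g, rfl⟩ hgN).trans (map_zero i).symm)
  have hVq : V ∈ comap (q.comp i) (𝓝 0) := by
    rw [AddMonoidHom.coe_comp, ← comap_comap]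
    exact ⟨U, hWU N hNW, hUV⟩
  have hind : IsInducing (q ∘ i) := hmin (q.comp i) (hq.comp hi.continuous) hinj hVq
  refine (AddSubgroup.eq_bot_iff_forall N).2 fun y hy => ?_
  have hqy : q y = q (i 0) := by
    rw [map_zero, map_zero]
    exact (QuotientAddGroup.eq_zero_iff y).2 hy
  rw [eq_of_map_eq_of_isInducing_comp hi.continuous hi.dense hq hind hqy, map_zero]

theorem surjective_of_isDenseEmbedding {G K : Type*} [AddCommGroup G] [TopologicalSpace G]
    [IsTopologicalAddGroup G] [AddCommGroup K] [TopologicalSpace K] [IsTopologicalAddGroup K]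
    [T2Space K] (hG : IsLocallyMinimalAddGroup G) (hexp : Squarefree (AddMonoid.exponent G))
    {i : G →+ K} (hi : IsDenseEmbedding i) : Function.Surjective i :=
  AddMonoidHom.range_eq_top.1 <| (hG.isLocallyEssential_range hi).eq_top_of_dense hi.dense hexp
    (exponent_nsmul_eq_zero_of_denseRange hi.dense)

theorem completeSpace {G : Type*} [AddCommGroup G] [UniformSpace G] [IsUniformAddGroup G]
    (hG : IsLocallyMinimalAddGroup G) (hexp : Squarefree (AddMonoid.exponent G)) :
    CompleteSpace G := by
  have : T2Space G := hG.1
  have hdense : IsDenseEmbedding (UniformSpace.Completion.toCompl : G →+ _) :=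
    UniformSpace.Completion.isDenseEmbedding_coe
  exact (UniformSpace.Completion.isUniformInducing_coe G).completeSpace_congr
    (hG.surjective_of_isDenseEmbedding hexp hdense) |>.2 inferInstance

end IsLocallyMinimalAddGroup

theorem IsPrecompactAddGroup.totallyBounded_univ {G : Type*} [AddCommGroup G] [UniformSpace G]
    [IsUniformAddGroup G] (hG : IsPrecompactAddGroup G) : TotallyBounded (Set.univ : Set G) := by
  have : CompactSpace (UniformSpace.Completion G) := by
    rwa [IsPrecompactAddGroup, IsUniformAddGroup.rightUniformSpace_eq] at hG
  exact totallyBounded_preimage (UniformSpace.Completion.isUniformInducing_coe G)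
    isCompact_univ.totallyBounded

theorem IsLocallyMinimalAddGroup.compactSpace {G : Type*} [AddCommGroup G] [TopologicalSpace G]
    [IsTopologicalAddGroup G] (hG : IsLocallyMinimalAddGroup G) (hpre : IsPrecompactAddGroup G)
    (hexp : Squarefree (AddMonoid.exponent G)) : CompactSpace G := by
  let _ : UniformSpace G := IsTopologicalAddGroup.rightUniformSpace G
  have : IsUniformAddGroup G := isUniformAddGroup_of_addCommGroup
  have : CompleteSpace G := hG.completeSpace hexp
  exact isCompact_univ_iff.1
    (isCompact_iff_totallyBounded_isComplete.2 ⟨hpre.totallyBounded_univ, isComplete_univ⟩)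

theorem corollary4p7 (G : Type*) [AddCommGroup G] [TopologicalSpace G]
    [IsTopologicalAddGroup G] [T2Space G] (hpre : IsPrecompactAddGroup G)
    (hexp : Squarefree (AddMonoid.exponent G)) :
    List.TFAE [CompactSpace G, IsMinimalAddGroup G, IsLocallyMinimalAddGroup G] := by
  tfae_have 1 → 2 := fun _ => isMinimalAddGroup_of_compactSpace G
  tfae_have 2 → 3 := fun h => h.isLocallyMinimalAddGroup
  tfae_have 3 → 1 := fun h => h.compactSpace hpre hexp
  tfae_finish
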